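/- Let $q$ be a prime power and let $X\subseteq\mathbb{P}^2$ be the Hermitian curve $y^qz+yz^q=x^{q+1}$ over $\mathbb{F}_{q^2}$, with point at infinity $P_\infty=(0:1:0)$. Put $B:=X(\mathbb{F}_{q^2})\setminus\{P_\infty\}$. Let $d,a$ be integers with $0<d<q$ and $1\le a\le d$, and let $H\subseteq B$ be a nonempty subset. Let $C(d,a,H)\subseteq\mathbb{F}_{q^2}^{B\setminus H}$ be the code obtained by evaluating, at the points of $B\setminus H$ (in coordinates $(x:y:1)$), the space $H^0(X,\mathcal{O}_X(d)(-aP_\infty))$ of the degree $d$ homogeneous forms on $X$ that vanish on the scheme $aP_\infty$ (the closed subscheme of $X$ defined by the $a$-th power of the ideal sheaf of $P_\infty$). Let $C(d,a,H)^\perp$ be its dual code with respect to the standard product $v\cdot w=\sum_i v_iw_i$. The minimum distance of a code is the least Hamming distance between two distinct codewords, and is $\infty$ for the zero code. Then the minimum distance of $C(d,a,H)^\perp$ is at least $d+1$, and it equals $d+1$ if and only if there exist $d+1$ distinct points of $B\setminus H$ lying on a common line of $\mathbb{P}^2$ through $P_\infty$. -/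

import Mathlib

open MvPolynomial
open scoped LinearAlgebra.Projectivization

namespace HermitianCode

section Codes

variable {K ι : Type*} [Field K] [Fintype ι]

/-- The minimum distance of a code: the least Hamming distance of two distinct codewords;
it is `⊤` for the zero code. -/
noncomputable def minDist [DecidableEq K] (C : Submodule K (ι → K)) : ℕ∞ :=
  ⨅ (v ∈ C) (w ∈ C) (_ : v ≠ w), (hammingDist v w : ℕ∞)

/-- The dual code, for the standard product `v ⬝ᵥ c = ∑ i, v i * c i`. -/
def dualCode (C : Submodule K (ι → K)) : Submodule K (ι → K) where
  carrier := {v | ∀ c ∈ C, v ⬝ᵥ c = 0}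
  zero_mem' := fun c _ => zero_dotProduct c
  add_mem' := fun hv hw c hc => by rw [add_dotProduct, hv c hc, hw c hc, add_zero]
  smul_mem' := fun r v hv c hc => by rw [smul_dotProduct, hv c hc, smul_zero]

end Codes

section Curve

variable (q : ℕ) (K : Type*) [Field K]

/-- The homogeneous equation `y ^ q * z + y * z ^ q - x ^ (q + 1)` of the Hermitian curve `X`,
with `x, y, z` the variables `0, 1, 2`. -/
noncomputable def hermitianPoly : MvPolynomial (Fin 3) K :=
  X 1 ^ q * X 2 + X 1 * X 2 ^ q - X 0 ^ (q + 1)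

/-- The `K`-rational points of `X`. -/
def rationalPoints : Set (ℙ K (Fin 3 → K)) :=
  {P | eval P.rep (hermitianPoly q K) = 0}

/-- The point at infinity `(0 : 1 : 0)`. -/
def pInf : ℙ K (Fin 3 → K) :=
  Projectivization.mk K ![0, 1, 0] (fun h => one_ne_zero (congrFun h 1))

/-- The set `B` of the `K`-rational points of `X` other than the point at infinity. -/
def affinePoints : Set (ℙ K (Fin 3 → K)) :=
  rationalPoints q K \ {pInf K}

variable {K} in
/-- The line of the projective plane with equation `l * x + m * y + n * z = 0`, where
`L = (l : m : n)`. -/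
def line (L : ℙ K (Fin 3 → K)) : Set (ℙ K (Fin 3 → K)) :=
  {P | P.orthogonal L}

/-- The homogeneous coordinate ring `K[x, y, z] / (y ^ q z + y z ^ q - x ^ (q + 1))` of `X`. -/
abbrev CoordRing : Type _ :=
  MvPolynomial (Fin 3) K ⧸ Ideal.span {hermitianPoly q K}

/-- The space `H⁰(X, 𝒪_X(d))` of the degree `d` homogeneous forms on `X`. -/
noncomputable def formsOn (d : ℕ) : Submodule K (CoordRing q K) :=
  (homogeneousSubmodule (Fin 3) K d).map
    (Ideal.Quotient.mkₐ K (Ideal.span {hermitianPoly q K})).toLinearMap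

/-- Setting `y = 1`: the passage to the affine chart `y ≠ 0`, with coordinates `u = x / y` and
`w = z / y` (the variables `0, 1`). The point at infinity is the origin of this chart. -/
noncomputable def dehomogenize : MvPolynomial (Fin 3) K →ₐ[K] MvPolynomial (Fin 2) K :=
  aeval ![X 0, 1, X 1]

/-- The coordinate ring of the affine curve `X ∩ {y ≠ 0}`. -/
abbrev ChartRing : Type _ :=
  MvPolynomial (Fin 2) K ⧸ Ideal.span {dehomogenize K (hermitianPoly q K)}

/-- Restriction of forms on `X` to the chart `y ≠ 0`, trivializing `𝒪_X(d)` there by `y ^ d`. -/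
noncomputable def toChart : CoordRing q K →ₐ[K] ChartRing q K :=
  Ideal.quotientMapₐ (Ideal.span {dehomogenize K (hermitianPoly q K)}) (dehomogenize K) (by
    rw [Ideal.span_singleton_le_iff_mem]
    exact Ideal.subset_span (Set.mem_singleton _))

/-- The maximal ideal of the point at infinity in the coordinate ring of the chart. -/
noncomputable def maxIdealInf : Ideal (ChartRing q K) :=
  Ideal.span {Ideal.Quotient.mk _ (X 0), Ideal.Quotient.mk _ (X 1)}

/-- The space `H⁰(X, 𝒪_X(d)(-a P∞))` of the degree `d` forms on `X` that vanish on the scheme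
`a P∞`; this closed subscheme of `X` lies in the chart `y ≠ 0`, where its ideal is the `a`-th
power of the maximal ideal of the point at infinity. -/
noncomputable def sections (d a : ℕ) : Submodule K (CoordRing q K) :=
  formsOn q K d ⊓
    ((maxIdealInf q K ^ a).restrictScalars K).comap (toChart q K).toLinearMap

variable {K}

/-- The homogeneous coordinates `(x : y : 1)` of a point of the affine plane `z ≠ 0`. -/
noncomputable def affineRep (P : ℙ K (Fin 3 → K)) : Fin 3 → K :=
  (P.rep 2)⁻¹ • P.rep

variable {q}

theorem eval_affineRep {P : ℙ K (Fin 3 → K)} (hP : P ∈ rationalPoints q K) :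
    eval (affineRep P) (hermitianPoly q K) = 0 := by
  have h : eval P.rep (hermitianPoly q K) = 0 := hP
  simp only [hermitianPoly, affineRep, map_sub, map_add, map_mul, map_pow, eval_X,
    Pi.smul_apply, smul_eq_mul] at h ⊢
  linear_combination (P.rep 2)⁻¹ ^ (q + 1) * h

variable (q)

/-- The value of a form on `X` at a rational point, in the coordinates `(x : y : 1)`. -/
noncomputable def evalAt (P : ℙ K (Fin 3 → K)) (hP : P ∈ rationalPoints q K) :
    CoordRing q K →ₐ[K] K :=
  Ideal.Quotient.liftₐ (Ideal.span {hermitianPoly q K}) (aeval (affineRep P)) (by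
    intro f hf
    obtain ⟨g, rfl⟩ := Ideal.mem_span_singleton'.1 hf
    rw [map_mul, aeval_eq_eval, eval_affineRep hP, mul_zero])

/-- The evaluation set `B \ H`, which indexes the coordinates of the punctured code. -/
abbrev EvalSet (H : Set (ℙ K (Fin 3 → K))) : Type _ :=
  ↥(affinePoints q K \ H)

noncomputable instance [Finite K] (H : Set (ℙ K (Fin 3 → K))) : Fintype (EvalSet q H) :=
  Fintype.ofFinite _

/-- The code `C(d, a, H)` obtained evaluating `H⁰(X, 𝒪_X(d)(-a P∞))` at the points of `B \ H`. -/
noncomputable def code (d a : ℕ) (H : Set (ℙ K (Fin 3 → K))) : Submodule K (EvalSet q H → K) :=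
  (sections q K d a).map
    (LinearMap.pi fun P : EvalSet q H => (evalAt q P.1 P.2.1.1).toLinearMap)

end Curve

end HermitianCode


/-!
Write `(x : y : 1)` for the points of `B`. The tangent at `P∞` is the line `z = 0`, which meets the
curve there with multiplicity at least `q`; hence for `a ≤ d` and `a ≤ q` the code contains the
evaluations of all forms of degree less than `d` and of all products of `d` lines through `P∞`. Let
`T` be the support of a nonzero word of the dual code, so that no codeword is nonzero at exactly one
point of `T`. If `#T ≤ d`, a product of `#T - 1` lines separates a point of `T` from the others. Let
`#T = d + 1`. If the abscissas on `T` are distinct, a product of `d` vertical lines does so. If `T`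
has two points on one vertical line and a point `P` off it, then this line and `d - 2` others
separate `P` from the rest of `T`. So `T` lies on a vertical line.

Conversely, as `a ≥ 1`, the forms defining the code have no term `y ^ d`, so their restrictions to a
vertical line are polynomials of degree less than `d` in `y`, and any `d + 1` points of the line
support a nonzero dual word.
-/

namespace HermitianCode

section Codes

variable {K ι : Type*} [Field K] [Fintype ι]

theorem natCast_le_minDist_iff [DecidableEq K] {C : Submodule K (ι → K)} {n : ℕ} :
    (n : ℕ∞) ≤ minDist C ↔ ∀ u ∈ C, u ≠ 0 → n ≤ hammingNorm u := by
  simp only [minDist, le_iInf_iff, Nat.cast_le]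
  constructor
  · intro h u hu hu0
    simpa only [hammingDist_zero_right] using h u hu 0 C.zero_mem hu0
  · intro h v hv w hw hvw
    rw [hammingDist_comm, hammingDist_eq_hammingNorm, neg_add_eq_sub]
    exact h _ (C.sub_mem hv hw) (sub_ne_zero.2 hvw)

theorem minDist_le_natCast_iff [DecidableEq K] {C : Submodule K (ι → K)} {n : ℕ} :
    minDist C ≤ n ↔ ∃ u ∈ C, u ≠ 0 ∧ hammingNorm u ≤ n := by
  rw [← not_lt, ← Order.add_one_le_iff_of_not_isMax (by simp), ← Nat.cast_add_one,
    natCast_le_minDist_iff]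
  push Not
  simp only [Nat.lt_succ_iff]

theorem exists_ne_of_mem_dualCode {C : Submodule K (ι → K)} {u c : ι → K} (hu : u ∈ dualCode C)
    (hc : c ∈ C) {i : ι} (hui : u i ≠ 0) (hci : c i ≠ 0) : ∃ j ≠ i, u j ≠ 0 ∧ c j ≠ 0 := by
  have hsum : ∑ j, u j * c j = 0 := hu c hc
  by_contra! h
  rw [Finset.sum_eq_single i (fun j _ hji => mul_eq_zero.2 (or_iff_not_imp_left.2 (h j hji)))
    (by simp)] at hsum
  exact mul_ne_zero hui hci hsum

theorem exists_mem_dualCode_of_finrank_lt_card {C : Submodule K (ι → K)} {V : Type*}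
    [AddCommGroup V] [Module K V] [FiniteDimensional K V] (φ : V →ₗ[K] ι → K) {T : Finset ι}
    (hT : Module.finrank K V < T.card) (hC : ∀ c ∈ C, ∃ v, ∀ i ∈ T, c i = φ v i) :
    ∃ u ∈ dualCode C, u ≠ 0 ∧ ∀ i, u i ≠ 0 → i ∈ T := by
  classical
  let coord (i : ι) : Module.Dual K V := LinearMap.proj i ∘ₗ φ
  have hdep : ¬ LinearIndepOn K coord (T : Set ι) := fun h => by
    have := h.linearIndependent.fintype_card_le_finrank
    rw [Subspace.dual_finrank_eq] at this
    simp only [Finset.coe_sort_coe, Fintype.card_coe] at this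
    omega
  obtain ⟨f, hf, i, hiT, hi⟩ := not_linearIndepOn_finset_iff.1 hdep
  refine ⟨fun i => if i ∈ T then f i else 0, fun c hc => ?_, ?_, fun j hj => ?_⟩
  · obtain ⟨v, hv⟩ := hC c hc
    calc (∑ j, (if j ∈ T then f j else 0) * c j) = ∑ j ∈ T, f j * c j := by
          simp [ite_mul]
      _ = ∑ j ∈ T, f j * φ v j := Finset.sum_congr rfl fun j hj => by rw [hv j hj]
      _ = (∑ j ∈ T, f j • coord j) v := by simp [coord]
      _ = 0 := by rw [hf, LinearMap.zero_apply]
  · exact Function.ne_iff.2 ⟨i, by simpa [hiT] using hi⟩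
  · exact by_contra fun h => hj (if_neg h)

end Codes

section Forms

variable {σ R : Type*} [CommRing R]

theorem exists_linearForm_separating {k : σ} {v w : σ → R} (hv : v k = 1) (hw : w k = 1)
    (hvw : v ≠ w) : ∃ F : MvPolynomial σ R, F.IsHomogeneous 1 ∧ eval v F ≠ 0 ∧ eval w F = 0 := by
  obtain ⟨i, hi⟩ := Function.ne_iff.1 hvw
  refine ⟨X i - C (w i) * X k, (isHomogeneous_X R i).sub (isHomogeneous_C_mul_X _ k), ?_, ?_⟩
  · simpa [hv, sub_eq_zero] using hi
  · simp [hw]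

theorem exists_form_separating [IsDomain R] {ι : Type*} (S : Finset ι) (p : ι → σ → R) {k : σ}
    {v : σ → R} (hv : v k = 1) (hp : ∀ i ∈ S, p i k = 1) (hvp : ∀ i ∈ S, v ≠ p i) :
    ∃ F : MvPolynomial σ R, F.IsHomogeneous S.card ∧ eval v F ≠ 0 ∧
      ∀ i ∈ S, eval (p i) F = 0 := by
  choose! F hF hFv hFp using fun i (hi : i ∈ S) =>
    exists_linearForm_separating hv (hp i hi) (hvp i hi)
  refine ⟨∏ i ∈ S, F i, ?_, ?_, fun i hi => ?_⟩
  · simpa using IsHomogeneous.prod S F (fun _ => 1) hF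
  · rw [map_prod]
    exact Finset.prod_ne_zero_iff.2 hFv
  · rw [map_prod]
    exact Finset.prod_eq_zero hi (hFp i hi)

theorem eval_single_one_of_isHomogeneous [DecidableEq σ] {d : ℕ} {F : MvPolynomial σ R}
    (hF : F.IsHomogeneous d) (i : σ) :
    eval (Pi.single i 1) F = coeff (Finsupp.single i d) F := by
  rw [eval_eq, Finset.sum_eq_single (Finsupp.single i d)]
  · rw [Finset.prod_eq_one fun j hj => ?_, mul_one]
    have hji : j = i := Finset.mem_singleton.1 (Finsupp.support_single_subset hj)
    rw [hji, Pi.single_eq_same, one_pow]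
  · intro m hm hmd
    obtain ⟨j, hj, hji⟩ : ∃ j ∈ m.support, j ≠ i := by
      by_contra! h
      have hmi : m = Finsupp.single i (m i) :=
        Finsupp.eq_single_iff.2 ⟨fun j hj => Finset.mem_singleton.2 (h j hj), rfl⟩
      have hdeg := hF.degree_eq_sum_deg_support hm
      rw [← Finsupp.degree_apply, hmi, Finsupp.degree_single] at hdeg
      exact hmd (hdeg ▸ hmi)
    have hzero : (Pi.single i 1 : σ → R) j ^ m j = 0 := by
      rw [Pi.single_eq_of_ne hji, zero_pow (Finsupp.mem_support_iff.1 hj)]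
    rw [Finset.prod_eq_zero hj hzero, mul_zero]
  · intro hm
    rw [notMem_support_iff.1 hm, zero_mul]

theorem degree_aeval_C_X_one_lt {d : ℕ} {F : MvPolynomial (Fin 3) R} (hF : F.IsHomogeneous d)
    (hFd : coeff (Finsupp.single 1 d) F = 0) (c : R) :
    (aeval ![Polynomial.C c, Polynomial.X, 1] F : Polynomial R).degree < d := by
  rw [← Polynomial.mem_degreeLT, aeval_def, eval₂_eq']
  refine Submodule.sum_mem _ fun m hm => ?_
  have hdeg : d = m 0 + m 1 + m 2 := by
    rw [hF.degree_eq_sum_deg_support hm, ← Finsupp.degree_apply, Finsupp.degree_eq_sum,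
      Fin.sum_univ_three]
  have hlt : m 1 < d := by
    by_contra! h
    refine mem_support_iff.1 hm ?_
    convert hFd
    ext i
    fin_cases i <;> simp <;> omega
  have hterm : algebraMap R (Polynomial R) (coeff m F) *
      ∏ i, ![Polynomial.C c, Polynomial.X, 1] i ^ m i =
        Polynomial.C (coeff m F * c ^ m 0) * Polynomial.X ^ m 1 := by
    simp [Fin.prod_univ_three, mul_assoc]
  rw [hterm, Polynomial.mem_degreeLT]
  exact (Polynomial.degree_C_mul_X_pow_le _ _).trans_lt (by exact_mod_cast hlt)

end Forms

section Points

variable {K : Type*} [Field K]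

theorem rep_two_ne_zero {q : ℕ} (hq : q ≠ 0) {P : ℙ K (Fin 3 → K)} (hP : P ∈ affinePoints q K) :
    P.rep 2 ≠ 0 := by
  intro h2
  have h : eval P.rep (hermitianPoly q K) = 0 := hP.1
  have h0 : P.rep 0 = 0 := by simpa [hermitianPoly, h2, hq] using h
  apply hP.2
  rw [Set.mem_singleton_iff, ← P.mk_rep, pInf, Projectivization.mk_eq_mk_iff']
  refine ⟨P.rep 1, ?_⟩
  ext i
  fin_cases i <;> simp [h0, h2]

theorem affineRep_two {P : ℙ K (Fin 3 → K)} (hP : P.rep 2 ≠ 0) : affineRep P 2 = 1 :=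
  inv_mul_cancel₀ hP

theorem mk_affineRep {P : ℙ K (Fin 3 → K)} (h : affineRep P ≠ 0) :
    Projectivization.mk K (affineRep P) h = P := by
  conv_rhs => rw [← P.mk_rep]
  exact (Projectivization.mk_eq_mk_iff' ..).2 ⟨_, rfl⟩

theorem affineRep_ne_zero {P : ℙ K (Fin 3 → K)} (hP : P.rep 2 ≠ 0) : affineRep P ≠ 0 :=
  smul_ne_zero (inv_ne_zero hP) P.rep_nonzero

theorem affineRep_injOn : Set.InjOn affineRep {P : ℙ K (Fin 3 → K) | P.rep 2 ≠ 0} := by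
  intro P hP Q hQ h
  rw [← mk_affineRep (affineRep_ne_zero hP), ← mk_affineRep (affineRep_ne_zero hQ)]
  simp only [h]

theorem mem_line_mk_iff {P : ℙ K (Fin 3 → K)} (hP : P.rep 2 ≠ 0) {v : Fin 3 → K} (hv : v ≠ 0) :
    P ∈ line (Projectivization.mk K v hv) ↔
      affineRep P 0 * v 0 + affineRep P 1 * v 1 + v 2 = 0 := by
  rw [line, Set.mem_ofPred_eq, ← mk_affineRep (affineRep_ne_zero hP),
    Projectivization.orthogonal_mk, dotProduct, Fin.sum_univ_three,
    mk_affineRep, affineRep_two hP, one_mul]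

theorem pInf_mem_line_mk_iff {v : Fin 3 → K} (hv : v ≠ 0) :
    pInf K ∈ line (Projectivization.mk K v hv) ↔ v 1 = 0 := by
  rw [line, Set.mem_ofPred_eq, pInf, Projectivization.orthogonal_mk]
  simp [dotProduct, Fin.sum_univ_three]

theorem exists_line_through_pInf_iff {S : Set (ℙ K (Fin 3 → K))} (hS : ∀ P ∈ S, P.rep 2 ≠ 0) :
    (∃ L : ℙ K (Fin 3 → K), pInf K ∈ line L ∧ S ⊆ line L) ↔
      ∃ c, ∀ P ∈ S, affineRep P 0 = c := by
  constructor
  · rintro ⟨L, hL, hSL⟩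
    induction L using Projectivization.ind with | h v hv =>
    have hv1 : v 1 = 0 := (pInf_mem_line_mk_iff hv).1 hL
    refine ⟨-v 2 / v 0, fun P hP => ?_⟩
    have hPL := (mem_line_mk_iff (hS P hP) hv).1 (hSL hP)
    rw [hv1, mul_zero, add_zero] at hPL
    have hv0 : v 0 ≠ 0 := by
      intro hv0
      have hv2 : v 2 = 0 := by simpa [hv0] using hPL
      exact hv (funext fun i => by fin_cases i <;> assumption)
    rw [eq_div_iff hv0]
    exact eq_neg_of_add_eq_zero_left hPL
  · rintro ⟨c, hc⟩
    have hv : ![1, 0, -c] ≠ 0 := fun h => one_ne_zero (congrFun h 0)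
    refine ⟨Projectivization.mk K _ hv, (pInf_mem_line_mk_iff hv).2 rfl, fun P hP => ?_⟩
    exact (mem_line_mk_iff (hS P hP) hv).2 (by simp [hc P hP])

end Points

section Sections

variable {q : ℕ} {K : Type*} [Field K]

/-- The linear form of the line `x = c z` through the point at infinity. -/
noncomputable def verticalForm (c : K) : MvPolynomial (Fin 3) K :=
  X 0 - C c * X 2

theorem isHomogeneous_verticalForm (c : K) : (verticalForm c).IsHomogeneous 1 :=
  (isHomogeneous_X K 0).sub (isHomogeneous_C_mul_X c 2)

theorem eval_affineRep_verticalForm {P : ℙ K (Fin 3 → K)} (hP : P.rep 2 ≠ 0) (c : K) :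
    eval (affineRep P) (verticalForm c) = affineRep P 0 - c := by
  simp [verticalForm, affineRep_two hP]

theorem mk_X_mem_maxIdealInf (i : Fin 2) : Ideal.Quotient.mk _ (X i) ∈ maxIdealInf q K :=
  Ideal.subset_span (by fin_cases i <;> simp)

theorem mk_dehomogenize_verticalForm_mem_maxIdealInf (c : K) :
    Ideal.Quotient.mk _ (dehomogenize K (verticalForm c)) ∈ maxIdealInf q K := by
  have h : dehomogenize K (verticalForm c) = X 0 - C c * X 1 := by
    simp [verticalForm, dehomogenize]
  rw [h, map_sub, map_mul]
  exact sub_mem (mk_X_mem_maxIdealInf 0) (Ideal.mul_mem_left _ _ (mk_X_mem_maxIdealInf 1))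

theorem mk_dehomogenize_X_two_mem_maxIdealInf_pow :
    Ideal.Quotient.mk _ (dehomogenize K (X 2)) ∈ maxIdealInf q K ^ q := by
  -- On the curve, `w = u ^ (q + 1) - w ^ q` in the coordinates of the chart.
  have hcurve : (Ideal.Quotient.mk (Ideal.span {dehomogenize K (hermitianPoly q K)}))
      (dehomogenize K (X 2) - (X 0 ^ (q + 1) - X 1 ^ q)) = 0 := by
    rw [Ideal.Quotient.eq_zero_iff_mem]
    convert Ideal.mem_span_singleton_self (dehomogenize K (hermitianPoly q K)) using 1
    simp only [dehomogenize, hermitianPoly, map_sub, map_add, map_mul, map_pow, aeval_X,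
      Matrix.cons_val, one_pow, one_mul]
    ring
  rw [map_sub, sub_eq_zero] at hcurve
  rw [hcurve, map_sub, map_pow, map_pow]
  exact sub_mem (Ideal.pow_le_pow_right q.le_succ (Ideal.pow_mem_pow (mk_X_mem_maxIdealInf 0) _))
    (Ideal.pow_mem_pow (mk_X_mem_maxIdealInf 1) _)

theorem constantCoeff_eq_zero_of_mk_mem_maxIdealInf (hq : q ≠ 0) {G : MvPolynomial (Fin 2) K}
    (hG : Ideal.Quotient.mk _ G ∈ maxIdealInf q K) : constantCoeff G = 0 := by
  have hcurve : Ideal.span {dehomogenize K (hermitianPoly q K)} ≤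
      RingHom.ker (constantCoeff : MvPolynomial (Fin 2) K →+* K) := by
    rw [Ideal.span_singleton_le_iff_mem, RingHom.mem_ker]
    simp [dehomogenize, hermitianPoly, hq]
  have hle : maxIdealInf q K ≤
      (RingHom.ker (constantCoeff : MvPolynomial (Fin 2) K →+* K)).map (Ideal.Quotient.mk _) := by
    rw [maxIdealInf, Ideal.span_le]
    rintro _ (rfl | rfl) <;>
      exact Ideal.mem_map_of_mem _ (RingHom.mem_ker.2 (constantCoeff_X K _))
  exact (Ideal.mem_quotient_iff_mem hcurve).1 (hle hG)

theorem constantCoeff_dehomogenize (F : MvPolynomial (Fin 3) K) :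
    constantCoeff (dehomogenize K F) = eval (Pi.single 1 1) F := by
  suffices h : constantCoeff.comp (dehomogenize K).toRingHom = eval (Pi.single 1 1) from
    RingHom.congr_fun h F
  refine ringHom_ext (fun c => ?_) fun i => ?_
  · simp [dehomogenize]
  · fin_cases i <;> simp [dehomogenize]

end Sections

section Code

variable {q d a : ℕ} {K : Type*} [Field K] {H : Set (ℙ K (Fin 3 → K))}

theorem EvalSet.rep_two_ne_zero (hq : q ≠ 0) (P : EvalSet q H) : P.1.rep 2 ≠ 0 :=
  HermitianCode.rep_two_ne_zero hq P.2.1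

theorem EvalSet.exists_form_separating (hq : q ≠ 0) {P : EvalSet q H} {T : Finset (EvalSet q H)}
    (hP : P ∉ T) : ∃ F : MvPolynomial (Fin 3) K, F.IsHomogeneous T.card ∧
      eval (affineRep P.1) F ≠ 0 ∧ ∀ Q ∈ T, eval (affineRep Q.1) F = 0 :=
  HermitianCode.exists_form_separating T (fun Q => affineRep Q.1)
    (affineRep_two (P.rep_two_ne_zero hq)) (fun Q _ => affineRep_two (Q.rep_two_ne_zero hq))
    fun Q hQ hPQ => hP <| by
      rwa [Subtype.ext (affineRep_injOn (P.rep_two_ne_zero hq) (Q.rep_two_ne_zero hq) hPQ)]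

theorem exists_finset_on_line_through_pInf_iff (hq : q ≠ 0) (n : ℕ) :
    (∃ S : Finset (ℙ K (Fin 3 → K)), (S : Set (ℙ K (Fin 3 → K))) ⊆ affinePoints q K \ H ∧
        S.card = n ∧ ∃ L : ℙ K (Fin 3 → K), pInf K ∈ line L ∧
          (S : Set (ℙ K (Fin 3 → K))) ⊆ line L) ↔
      ∃ T : Finset (EvalSet q H), T.card = n ∧ ∃ c, ∀ P ∈ T, affineRep P.1 0 = c := by
  classical
  constructor
  · rintro ⟨S, hSB, rfl, hS⟩
    rw [exists_line_through_pInf_iff fun P hP => rep_two_ne_zero hq (hSB hP).1] at hS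
    lift S to Finset (EvalSet q H) using hSB
    exact ⟨S, (Finset.card_image_of_injective S Subtype.val_injective).symm, by simpa using hS⟩
  · rintro ⟨T, rfl, hT⟩
    have hTB : ↑(T.map (Function.Embedding.subtype _)) ⊆ affinePoints q K \ H := fun P hP => by
      obtain ⟨P, -, rfl⟩ := Finset.mem_map.1 hP
      exact P.2
    refine ⟨T.map (Function.Embedding.subtype _), hTB, T.card_map _, ?_⟩
    rw [exists_line_through_pInf_iff fun P hP => rep_two_ne_zero hq (hTB hP).1]
    simpa using hT

theorem mem_code_iff {c : EvalSet q H → K} :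
    c ∈ code q d a H ↔ ∃ F : MvPolynomial (Fin 3) K, F.IsHomogeneous d ∧
      Ideal.Quotient.mk _ (dehomogenize K F) ∈ maxIdealInf q K ^ a ∧
      ∀ P, c P = eval (affineRep P.1) F := by
  have hval (P : EvalSet q H) (F : MvPolynomial (Fin 3) K) :
      evalAt q P.1 P.2.1.1 (Ideal.Quotient.mk _ F) = eval (affineRep P.1) F := by
    simp [evalAt]
  constructor
  · rintro ⟨_, ⟨⟨F, hF, rfl⟩, hFa⟩, rfl⟩
    exact ⟨F, hF, hFa, fun P => hval P F⟩
  · rintro ⟨F, hF, hFa, hFc⟩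
    refine ⟨Ideal.Quotient.mk _ F, ⟨⟨F, hF, rfl⟩, hFa⟩, ?_⟩
    ext P
    rw [hFc]
    exact hval P F

theorem eval_mem_code_of_isHomogeneous_of_lt (hq : q ≠ 0) (haq : a ≤ q) {e : ℕ} (he : e < d)
    {F : MvPolynomial (Fin 3) K} (hF : F.IsHomogeneous e) :
    (fun P : EvalSet q H => eval (affineRep P.1) F) ∈ code q d a H := by
  refine mem_code_iff.2 ⟨X 2 ^ (d - e) * F, ?_, ?_, fun P => ?_⟩
  · convert (isHomogeneous_X_pow 2 (d - e)).mul hF using 1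
    omega
  · rw [map_mul, map_mul, map_pow, map_pow]
    exact Ideal.mul_mem_right _ _ (Ideal.pow_mem_of_mem _
      (Ideal.pow_le_pow_right haq mk_dehomogenize_X_two_mem_maxIdealInf_pow) _ (by omega))
  · simp [affineRep_two (P.rep_two_ne_zero hq)]

theorem eval_prod_verticalForm_mem_code (had : a ≤ d) {ι : Type*} {S : Finset ι}
    (hS : S.card = d) (x : ι → K) :
    (fun P : EvalSet q H => eval (affineRep P.1) (∏ i ∈ S, verticalForm (x i))) ∈
      code q d a H := by
  refine mem_code_iff.2 ⟨_, ?_, ?_, fun P => rfl⟩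
  · simpa [hS] using IsHomogeneous.prod S (fun i => verticalForm (x i)) (fun _ => 1)
      fun i _ => isHomogeneous_verticalForm (x i)
  · rw [map_prod, map_prod]
    refine Ideal.pow_le_pow_right had ?_
    rw [← hS, ← Finset.prod_const (s := S) (maxIdealInf q K)]
    exact Ideal.prod_mem_prod fun i _ => mk_dehomogenize_verticalForm_mem_maxIdealInf (x i)

theorem exists_polynomial_of_mem_code (hq : q ≠ 0) (ha : a ≠ 0) {w : EvalSet q H → K}
    (hw : w ∈ code q d a H) (c : K) :
    ∃ p ∈ Polynomial.degreeLT K d, ∀ P : EvalSet q H, affineRep P.1 0 = c →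
      w P = p.eval (affineRep P.1 1) := by
  obtain ⟨F, hF, hFa, hFw⟩ := mem_code_iff.1 hw
  have hFd : coeff (Finsupp.single 1 d) F = 0 := by
    rw [← eval_single_one_of_isHomogeneous hF, ← constantCoeff_dehomogenize]
    exact constantCoeff_eq_zero_of_mk_mem_maxIdealInf hq (Ideal.pow_le_self ha hFa)
  refine ⟨_, Polynomial.mem_degreeLT.2 (degree_aeval_C_X_one_lt hF hFd c), fun P hP => ?_⟩
  rw [hFw]
  suffices h : eval (affineRep P.1) = (Polynomial.evalRingHom (affineRep P.1 1)).comp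
      (aeval ![Polynomial.C c, Polynomial.X, 1]).toRingHom from RingHom.congr_fun h F
  refine ringHom_ext (fun b => ?_) fun i => ?_
  · simp
  · fin_cases i <;> simp [hP, affineRep_two (P.rep_two_ne_zero hq)]

end Code

section DualCode

variable {q d a : ℕ} {K : Type*} [Field K] {H : Set (ℙ K (Fin 3 → K))}
  [Fintype (EvalSet q H)] {u : EvalSet q H → K}

theorem lt_hammingNorm_of_mem_dualCode [DecidableEq K] (hq : q ≠ 0) (haq : a ≤ q)
    (hu : u ∈ dualCode (code q d a H)) (hu0 : u ≠ 0) : d < hammingNorm u := by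
  classical
  by_contra! hud
  let T : Finset (EvalSet q H) := {P | u P ≠ 0}
  obtain ⟨P, hP⟩ := Function.ne_iff.1 hu0
  have hPT : P ∈ T := by simpa [T] using hP
  obtain ⟨F, hF, hFP, hFT⟩ := EvalSet.exists_form_separating hq (T.notMem_erase P)
  have hdeg : (T.erase P).card < d := (Finset.card_erase_lt_of_mem hPT).trans_le hud
  obtain ⟨Q, hQP, hQ, hFQ⟩ := exists_ne_of_mem_dualCode hu
    (eval_mem_code_of_isHomogeneous_of_lt hq haq hdeg hF) hP hFP
  exact hFQ (hFT Q (by simp [T, hQP, hQ]))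

theorem exists_ne_affineRep_zero_eq [DecidableEq K] (hq : q ≠ 0) (had : a ≤ d)
    (hu : u ∈ dualCode (code q d a H)) (hud : hammingNorm u = d + 1) :
    ∃ P Q, u P ≠ 0 ∧ u Q ≠ 0 ∧ P ≠ Q ∧ affineRep P.1 0 = affineRep Q.1 0 := by
  classical
  by_contra! hinj
  let T : Finset (EvalSet q H) := {P | u P ≠ 0}
  have hT : T.card = d + 1 := hud
  obtain ⟨P, hPT⟩ : T.Nonempty := Finset.card_pos.1 (by omega)
  have hP : u P ≠ 0 := by simpa [T] using hPT
  have hcard : (T.erase P).card = d := by rw [Finset.card_erase_of_mem hPT, hT, Nat.add_sub_cancel]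
  have hval (Q : EvalSet q H) :
      eval (affineRep Q.1) (∏ R ∈ T.erase P, verticalForm (affineRep R.1 0)) =
        ∏ R ∈ T.erase P, (affineRep Q.1 0 - affineRep R.1 0) := by
    simp only [map_prod, eval_affineRep_verticalForm (Q.rep_two_ne_zero hq)]
  obtain ⟨Q, hQP, hQ, hQ0⟩ := exists_ne_of_mem_dualCode hu
    (eval_prod_verticalForm_mem_code had hcard fun R => affineRep R.1 0) hP (by
      rw [hval]
      refine Finset.prod_ne_zero_iff.2 fun R hR => sub_ne_zero.2 ?_
      obtain ⟨hRP, hRT⟩ := Finset.mem_erase.1 hR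
      exact hinj P R hP (by simpa [T] using hRT) hRP.symm)
  rw [hval] at hQ0
  exact hQ0 (Finset.prod_eq_zero (i := Q) (by simp [T, hQP, hQ]) (sub_self _))

theorem affineRep_zero_eq_of_vertical_pair [DecidableEq K] (hq : q ≠ 0) (haq : a ≤ q)
    (hu : u ∈ dualCode (code q d a H)) (hud : hammingNorm u = d + 1) {P Q R : EvalSet q H}
    (hP : u P ≠ 0) (hQ : u Q ≠ 0) (hR : u R ≠ 0) (hQR : Q ≠ R)
    (hx : affineRep Q.1 0 = affineRep R.1 0) : affineRep P.1 0 = affineRep Q.1 0 := by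
  classical
  by_contra hPQ
  let T : Finset (EvalSet q H) := {S | u S ≠ 0}
  have hQP : Q ≠ P := by rintro rfl; exact hPQ rfl
  have hRP : R ≠ P := by rintro rfl; exact hPQ hx.symm
  obtain ⟨F, hF, hFP, hFT⟩ := EvalSet.exists_form_separating hq
    (by simp : P ∉ T \ {P, Q, R})
  have hdeg : 1 + (T \ {P, Q, R}).card < d := by
    have hsub : {P, Q, R} ⊆ T := by simp [Finset.insert_subset_iff, T, hP, hQ, hR]
    have hthree : ({P, Q, R} : Finset (EvalSet q H)).card = 3 :=
      Finset.card_eq_three.2 ⟨P, Q, R, hQP.symm, hRP.symm, hQR, rfl⟩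
    have hT : T.card = d + 1 := hud
    have hcard := Finset.card_sdiff_add_card_eq_card hsub
    omega
  have hval (S : EvalSet q H) : eval (affineRep S.1) (verticalForm (affineRep Q.1 0) * F) =
      (affineRep S.1 0 - affineRep Q.1 0) * eval (affineRep S.1) F := by
    rw [map_mul, eval_affineRep_verticalForm (S.rep_two_ne_zero hq)]
  obtain ⟨S, hSP, hS, hS0⟩ := exists_ne_of_mem_dualCode hu
    (eval_mem_code_of_isHomogeneous_of_lt hq haq hdeg ((isHomogeneous_verticalForm _).mul hF)) hP
    (by rw [hval]; exact mul_ne_zero (sub_ne_zero.2 hPQ) hFP)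
  rw [hval, mul_ne_zero_iff, sub_ne_zero] at hS0
  have hSQ : S ≠ Q := by rintro rfl; exact hS0.1 rfl
  have hSR : S ≠ R := by rintro rfl; exact hS0.1 hx.symm
  exact hS0.2 (hFT S (by simp [T, hS, hSP, hSQ, hSR]))

theorem exists_affineRep_zero_eq_of_hammingNorm_eq [DecidableEq K] (hq : q ≠ 0) (had : a ≤ d)
    (haq : a ≤ q) (hu : u ∈ dualCode (code q d a H)) (hud : hammingNorm u = d + 1) :
    ∃ c, ∀ P, u P ≠ 0 → affineRep P.1 0 = c := by
  obtain ⟨Q, R, hQ, hR, hQR, hx⟩ := exists_ne_affineRep_zero_eq hq had hu hud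
  exact ⟨_, fun P hP => affineRep_zero_eq_of_vertical_pair hq haq hu hud hP hQ hR hQR hx⟩

theorem exists_mem_dualCode_of_affineRep_zero_eq (hq : q ≠ 0) (ha : a ≠ 0)
    {T : Finset (EvalSet q H)} (hT : d < T.card) {c : K} (hc : ∀ P ∈ T, affineRep P.1 0 = c) :
    ∃ u ∈ dualCode (code q d a H), u ≠ 0 ∧ ∀ P, u P ≠ 0 → P ∈ T := by
  let φ : Polynomial.degreeLT K d →ₗ[K] EvalSet q H → K :=
    LinearMap.pi fun P => Polynomial.leval (affineRep P.1 1) ∘ₗ Submodule.subtype _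
  have hfinite : FiniteDimensional K (Polynomial.degreeLT K d) :=
    Module.Finite.equiv (Polynomial.degreeLTEquiv K d).symm
  refine exists_mem_dualCode_of_finrank_lt_card φ ?_ fun w hw => ?_
  · rwa [(Polynomial.degreeLTEquiv K d).finrank_eq, Module.finrank_fin_fun]
  · obtain ⟨p, hp, hpw⟩ := exists_polynomial_of_mem_code hq ha hw c
    exact ⟨⟨p, hp⟩, fun P hP => hpw P (hc P hP)⟩

theorem minDist_dualCode_code_le_iff [DecidableEq K] (hq : q ≠ 0) (ha : a ≠ 0) (had : a ≤ d)
    (haq : a ≤ q) :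
    minDist (dualCode (code q d a H)) ≤ (d + 1 : ℕ) ↔
      ∃ T : Finset (EvalSet q H), T.card = d + 1 ∧ ∃ c, ∀ P ∈ T, affineRep P.1 0 = c := by
  rw [minDist_le_natCast_iff]
  constructor
  · rintro ⟨u, hu, hu0, hud⟩
    have hud' : hammingNorm u = d + 1 :=
      hud.antisymm (lt_hammingNorm_of_mem_dualCode hq haq hu hu0)
    obtain ⟨c, hc⟩ := exists_affineRep_zero_eq_of_hammingNorm_eq hq had haq hu hud'
    exact ⟨Finset.univ.filter (u · ≠ 0), hud', c, fun P hP => hc P (Finset.mem_filter.1 hP).2⟩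
  · rintro ⟨T, hT, c, hc⟩
    obtain ⟨u, hu, hu0, huT⟩ :=
      exists_mem_dualCode_of_affineRep_zero_eq (d := d) hq ha (by omega) hc
    refine ⟨u, hu, hu0, hT ▸ Finset.card_le_card fun P hP => huT P (by simpa using hP)⟩

end DualCode

end HermitianCode

open HermitianCode in
theorem theorem6p4_general {q : ℕ} {K : Type*} [Field K] [DecidableEq K] {d a : ℕ} (ha : 1 ≤ a)
    (had : a ≤ d) (haq : a ≤ q) (H : Set (ℙ K (Fin 3 → K))) [Fintype (EvalSet q H)] :
    ((d + 1 : ℕ) : ℕ∞) ≤ minDist (dualCode (code q d a H)) ∧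
    (minDist (dualCode (code q d a H)) = ((d + 1 : ℕ) : ℕ∞) ↔
      ∃ S : Finset (ℙ K (Fin 3 → K)), (S : Set (ℙ K (Fin 3 → K))) ⊆ affinePoints q K \ H ∧
        S.card = d + 1 ∧ ∃ L : ℙ K (Fin 3 → K), pInf K ∈ line L ∧
          (S : Set (ℙ K (Fin 3 → K))) ⊆ line L) := by
  have hq : q ≠ 0 := by omega
  have hle : ((d + 1 : ℕ) : ℕ∞) ≤ minDist (dualCode (code q d a H)) :=
    natCast_le_minDist_iff.2 fun u hu hu0 => lt_hammingNorm_of_mem_dualCode hq haq hu hu0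
  refine ⟨hle, ?_⟩
  rw [exists_finset_on_line_through_pInf_iff hq,
    ← minDist_dualCode_code_le_iff hq (by omega) had haq]
  exact ⟨le_of_eq, fun h => h.antisymm hle⟩

theorem theorem6p4 (q : ℕ) (hq : IsPrimePow q) {K : Type*} [Field K] [Fintype K] [DecidableEq K]
    (hK : Fintype.card K = q ^ 2) (d a : ℕ) (hd : 0 < d) (hdq : d < q) (ha : 1 ≤ a) (had : a ≤ d)
    (H : Set (ℙ K (Fin 3 → K))) (hH : H.Nonempty) (hHB : H ⊆ HermitianCode.affinePoints q K) :
    ((d + 1 : ℕ) : ℕ∞) ≤ HermitianCode.minDist (HermitianCode.dualCode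
        (HermitianCode.code q d a H)) ∧
    (HermitianCode.minDist (HermitianCode.dualCode (HermitianCode.code q d a H)) =
        ((d + 1 : ℕ) : ℕ∞) ↔
      ∃ S : Finset (ℙ K (Fin 3 → K)), (S : Set (ℙ K (Fin 3 → K))) ⊆
          HermitianCode.affinePoints q K \ H ∧ S.card = d + 1 ∧
        ∃ L : ℙ K (Fin 3 → K), HermitianCode.pInf K ∈ HermitianCode.line L ∧
          (S : Set (ℙ K (Fin 3 → K))) ⊆ HermitianCode.line L) :=
  theorem6p4_general ha had (had.trans hdq.le) H
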